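/- A user streams a file of size $F\in[0,\infty]$ (the case $F=\infty$ being included), starting the playback, at unit rate, with $D\ge 0$ packets in the buffer. Packets from a free server arrive according to a Poisson process $N$ of rate $R_0\ge 0$, and packets from a costly server according to an independent Poisson process $N^c$ of rate $R_c\ge 0$. An off-line policy is a deterministic (measurable) function of time $u:\mathbb R\to\{0,1\}$, where $u_t=0$ means that only the free server is used at time $t$ and $u_t=1$ that both servers are used. Under $u$ the buffer size at time $t\ge 0$ is $$x_t = D+N_t+\int_{(0,t]}u_\tau\,dN^c_\tau-t .$$ Let $\tau_e=\inf\{t\ge 0:x_t\le 0\}$ and $\tau_f=\inf\{t\ge 0:x_t\ge F-t\}$ (with $\inf\emptyset=\infty$), let $p^u=\mathbb P\{\tau_e<\tau_f\}$ be the interruption probability, and let $U(u)=\mathbb E\big[\int_0^F u_t\,dt\big]=\int_0^F u_t\,dt\in[0,\infty]$ be the usage time of the costly server. For $\epsilon\in\mathbb R$ the cost of $u$ is $J^u(D,\epsilon)=U(u)$ if $p^u\le\epsilon$, and $J^u(D,\epsilon)=\infty$ otherwise. For $t_s\in[0,\infty]$ let $u^{(t_s)}$ be the policy with $u^{(t_s)}_t=1$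 for $t\le t_s$ and $u^{(t_s)}_t=0$ for $t>t_s$. Theorem. (a) For every off-line policy $u$, the policy $u'=u^{(t_s)}$ with $t_s=U(u)$ satisfies $U(u')=U(u)$ and $p^{u'}\le p^u$. (b) Consequently, in order to find a minimum-cost off-line policy it is sufficient to consider policies of the form $u^{(t_s)}$ with $t_s\in[0,\infty)$: for every $\epsilon$ and every off-line policy $u$ there is $t_s\in[0,\infty)$ with $J^{u^{(t_s)}}(D,\epsilon)\le J^u(D,\epsilon)$; moreover $$\inf_{u}J^u(D,\epsilon)=\inf_{0\le t_s<\infty}J^{u^{(t_s)}}(D,\epsilon),$$ where $u$ runs over all off-line policies, and a number $c\in[0,\infty]$ is the minimum (attained) of the left-hand family of costs if and only if it is the minimum (attained) of the right-hand one. -/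

import Mathlib

open MeasureTheory ProbabilityTheory
open scoped NNReal ENNReal

namespace Streaming

/-- A path of a counting process: it starts at `0`, is nondecreasing and right-continuous. -/
structure CountingPath where
  /-- number of arrivals up to a given time -/
  toFun : ℝ≥0 → ℕ
  zero' : toFun 0 = 0
  mono' : Monotone toFun
  rightCont' : ∀ t, ContinuousWithinAt toFun (Set.Ici t) t

instance : CoeFun CountingPath (fun _ => ℝ≥0 → ℕ) := ⟨CountingPath.toFun⟩

/-- The path, extended by `0` to negative times, as a Stieltjes function on the line. -/
noncomputable def CountingPath.stieltjes (f : CountingPath) : StieltjesFunction ℝ where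
  toFun t := (f t.toNNReal : ℝ)
  mono' _ _ h := Nat.cast_le.2 (f.mono' (Real.toNNReal_mono h))
  right_continuous' t := by
    have h1 : ContinuousWithinAt Real.toNNReal (Set.Ici t) t :=
      continuous_real_toNNReal.continuousWithinAt
    have h2 : ContinuousWithinAt (fun s : ℝ => f s.toNNReal) (Set.Ici t) t :=
      ContinuousWithinAt.comp (t := Set.Ici t.toNNReal) (f.rightCont' _) h1
        (fun _ hs => Real.toNNReal_mono hs)
    exact (continuous_of_discreteTopology (f := fun n : ℕ => (n : ℝ))).continuousAt.comp_continuousWithinAt h2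

variable {Ω : Type*} [MeasurableSpace Ω]

/-- `N` is a Poisson process of rate `r` under `P`: a counting process with independent
increments, whose increment over `(s, t]` has the Poisson law of mean `r (t - s)`. -/
structure IsPoissonProcess (P : Measure Ω) (r : ℝ≥0) (N : Ω → CountingPath) : Prop where
  measurable : ∀ t, Measurable (fun ω => N ω t)
  indepIncrements : HasIndepIncrements (fun t ω => N ω t) P
  law_increment : ∀ s t, s ≤ t →
    P.map (fun ω => N ω t - N ω s) = poissonMeasure (r * (t - s))

/-- The buffer size at time `t`,
`x_t = D + N_t + ∫_{(0,t]} a_τ dN^c_τ - t` (a pathwise Lebesgue–Stieltjes integral),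
when the actions are given by the process `a`: at time `τ` only the free server is used if
`a τ ω = 0`, and both servers are used if `a τ ω = 1`. -/
noncomputable def buffer (D : ℝ≥0) (N Nc : Ω → CountingPath) (a : ℝ → Ω → Fin 2)
    (t : ℝ≥0) (ω : Ω) : ℝ :=
  (D : ℝ) + (N ω t : ℝ)
    + (∫ τ in Set.Ioc (0 : ℝ) t, ((a τ ω : ℕ) : ℝ) ∂(Nc ω).stieltjes.measure) - (t : ℝ)

/-- `τ_e = inf {t : x_t ≤ 0}`, the time at which the buffer empties (`∞` if there is none). -/
noncomputable def emptyTime (D : ℝ≥0) (N Nc : Ω → CountingPath) (a : ℝ → Ω → Fin 2)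
    (ω : Ω) : ℝ≥0∞ :=
  ⨅ (t : ℝ≥0) (_ : buffer D N Nc a t ω ≤ 0), (t : ℝ≥0∞)

/-- `τ_f = inf {t : x_t ≥ F - t}`, the time at which the download of a file of size `F` is
complete (`∞` if there is none, in particular if `F = ∞`). -/
noncomputable def finishTime (F : ℝ≥0∞) (D : ℝ≥0) (N Nc : Ω → CountingPath)
    (a : ℝ → Ω → Fin 2) (ω : Ω) : ℝ≥0∞ :=
  ⨅ (t : ℝ≥0) (_ : (F : EReal) - ((t : ℝ) : EReal) ≤ (buffer D N Nc a t ω : EReal)), (t : ℝ≥0∞)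

/-- The interruption probability `P(τ_e < τ_f)`. -/
noncomputable def interruptionProb (P : Measure Ω) (F : ℝ≥0∞) (D : ℝ≥0)
    (N Nc : Ω → CountingPath) (a : ℝ → Ω → Fin 2) : ℝ :=
  P.real {ω | emptyTime D N Nc a ω < finishTime F D N Nc a ω}

/-- The expected usage time of the costly server, `E ∫_0^F a_t dt`. -/
noncomputable def expectedUsage (P : Measure Ω) (F : ℝ≥0∞) (a : ℝ → Ω → Fin 2) : ℝ≥0∞ :=
  ∫⁻ ω, ∫⁻ t in {t : ℝ | 0 ≤ t ∧ ENNReal.ofReal t ≤ F}, ((a t ω : ℕ) : ℝ≥0∞) ∂volume ∂P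

open Classical in
/-- The cost of an action process: the expected usage time of the costly server if the
interruption probability is at most `ε`, and `∞` if it is larger (infeasibility). -/
noncomputable def cost (P : Measure Ω) (F : ℝ≥0∞) (D : ℝ≥0) (ε : ℝ)
    (N Nc : Ω → CountingPath) (a : ℝ → Ω → Fin 2) : ℝ≥0∞ :=
  if interruptionProb P F D N Nc a ≤ ε then expectedUsage P F a else ⊤

/-- An off-line policy: a deterministic (measurable) function of time with values in `{0, 1}`. -/
structure OfflinePolicy where
  /-- the action at a given time -/
  toFun : ℝ → Fin 2
  measurable' : Measurable toFun

/-- The (nonrandom) action process of an off-line policy. -/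
def OfflinePolicy.action (u : OfflinePolicy) : ℝ → Ω → Fin 2 := fun t _ => u.toFun t

open Classical in
/-- The policy `u_t = 1` if `t ≤ t_s` and `u_t = 0` if `t > t_s`, for `t_s ∈ [0, ∞]`. -/
noncomputable def thresholdPolicy (ts : ℝ≥0∞) : OfflinePolicy where
  toFun t := if ENNReal.ofReal t ≤ ts then 1 else 0
  measurable' := Measurable.ite
    (measurableSet_le ENNReal.measurable_ofReal measurable_const) measurable_const measurable_const

end Streaming

namespace Streaming

open Set Filter Topology TopologicalSpace

/-! Let `B` be the set of times at which `u` uses the costly server, and put S(t) = D + N_t + N^c(B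
∩ (0,t]). Interruption means that S(t) ≤ t for some t < F (`emptyTime_lt_finishTime_iff`). The
counts N^c(B ∩ (0,t]) have the finite-dimensional laws of N^c run at the occupation time |B ∩ (0,t]|
(`IsPoissonProcess.map_measureReal_eq`), also jointly with the independent process N. For t < F this
occupation time is at most both t and U(u), so the policy with threshold U(u) is active on all of
(0, |B ∩ (0,t]|] (`Ioc_occupation_subset`). Path by path it therefore receives at least as many
packets by time t as the time-changed copy of `u`, and shortage is no more likely. Right-continuity
reduces the interruption event to countably many times, and continuity from below to finitely many,
so finite-dimensional laws suffice. The time change follows from independent increments when `B` is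
a finite union of intervals. A measurable `B` is approximated by such unions: an arrival in a set of
measure δ has probability at most rδ. -/

/-! ### Counting paths as random integer-valued measures. -/

lemma CountingPath.measure_Ioc (f : CountingPath) (a b : ℝ≥0) :
    f.stieltjes.measure (Ioc (a : ℝ) b) = ((f b - f a : ℕ) : ℝ≥0∞) := by
  rw [StieltjesFunction.measure_Ioc]
  simp only [stieltjes, Real.toNNReal_coe]
  rw [ENNReal.ofReal_sub _ (Nat.cast_nonneg _), ENNReal.ofReal_natCast, ENNReal.ofReal_natCast,
    ENNReal.natCast_sub]

lemma CountingPath.measure_Ioc_zero (f : CountingPath) (b : ℝ≥0) :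
    f.stieltjes.measure (Ioc (0 : ℝ) b) = (f b : ℝ≥0∞) := by
  simpa [f.zero'] using f.measure_Ioc 0 b

lemma CountingPath.measure_inter_Ioc_ne_top (f : CountingPath) (B : Set ℝ) (a b : ℝ) :
    f.stieltjes.measure (B ∩ Ioc a b) ≠ ∞ :=
  ((measure_mono inter_subset_right).trans_lt measure_Ioc_lt_top).ne

lemma Iic_inter_Ioc_zero (a : ℝ) (T : ℝ≥0) :
    Iic a ∩ Ioc 0 (T : ℝ) = Ioc 0 ((min a.toNNReal T : ℝ≥0) : ℝ) := by
  ext x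
  simp only [mem_inter_iff, mem_Iic, mem_Ioc, NNReal.coe_min, Real.coe_toNNReal', le_min_iff,
    le_max_iff]
  constructor
  · rintro ⟨h1, h2, h3⟩
    exact ⟨h2, Or.inl h1, h3⟩
  · rintro ⟨h1, h2 | h2, h3⟩
    · exact ⟨h2, h1, h3⟩
    · exact absurd h1 (not_lt.2 h2)

/-- A countable sum of natural numbers is a natural number if it is finite. -/
lemma exists_natCast_eq_tsum {a : ℕ → ℝ≥0∞} (ha : ∀ i, ∃ n : ℕ, a i = n)
    (h : ∑' i, a i ≠ ∞) : ∃ n : ℕ, ∑' i, a i = n := by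
  choose n hn using ha
  obtain rfl : a = fun i => (n i : ℝ≥0∞) := funext hn
  have hs : HasSum (fun i => ((n i : ℕ) : ℝ)) (∑' i, (n i : ℝ≥0∞)).toReal := by
    rw [ENNReal.tsum_toReal_eq fun _ => ENNReal.natCast_ne_top _]
    simpa only [ENNReal.toReal_natCast] using ENNReal.hasSum_toReal h
  -- The integers are closed in the line, so the limit of the partial sums is an integer.
  have hmem : (∑' i, (n i : ℝ≥0∞)).toReal ∈ range ((↑) : ℕ → ℝ) :=
    Nat.isClosedEmbedding_coe_real.isClosed_range.mem_of_tendsto hs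
      (Eventually.of_forall fun s => ⟨∑ i ∈ s, n i, by simp⟩)
  obtain ⟨k, hk⟩ := hmem
  refine ⟨k, ?_⟩
  rw [← ENNReal.ofReal_toReal h, ← hk, ENNReal.ofReal_natCast]

/-- The Lebesgue–Stieltjes measure of a counting path takes integer values on bounded sets. -/
lemma CountingPath.exists_measure_eq_natCast (f : CountingPath) (T : ℝ≥0) {B : Set ℝ}
    (hB : MeasurableSet B) : ∃ n : ℕ, f.stieltjes.measure (B ∩ Ioc 0 T) = n := by
  have htot := f.measure_Ioc_zero T
  have hfin : IsFiniteMeasure (f.stieltjes.measure.restrict (Ioc 0 (T : ℝ))) :=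
    ⟨by simp [htot]⟩
  suffices ∃ n : ℕ, f.stieltjes.measure.restrict (Ioc 0 (T : ℝ)) B = n by
    simpa [Measure.restrict_apply hB] using this
  induction B, hB using MeasurableSpace.induction_on_inter (borel_eq_generateFrom_Iic ℝ ▸
      (BorelSpace.measurable_eq (α := ℝ))) isPiSystem_Iic with
  | empty => exact ⟨0, by simp⟩
  | basic t ht =>
    obtain ⟨a, rfl⟩ := ht
    rw [Measure.restrict_apply measurableSet_Iic, Iic_inter_Ioc_zero, f.measure_Ioc_zero]
    exact ⟨_, rfl⟩
  | compl t ht ih =>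
    obtain ⟨n, hn⟩ := ih
    rw [measure_compl ht (measure_ne_top _ _), hn, Measure.restrict_apply_univ, htot]
    exact ⟨f T - n, by rw [ENNReal.natCast_sub]⟩
  | iUnion g hd hm ih =>
    rw [measure_iUnion hd hm]
    exact exists_natCast_eq_tsum ih (by rw [← measure_iUnion hd hm]; exact measure_ne_top _ _)

section Measurability

variable {Ω : Type*} [MeasurableSpace Ω]

/-- Restriction to (0, T] makes the measures finite, so testing on the π-system of half-lines is
enough. This turns the arrivals into a kernel, whose mean measure can be formed with `Measure.bind`.
-/
lemma measurable_restrict_stieltjes {N : Ω → CountingPath}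
    (hN : ∀ t, Measurable fun ω => N ω t) (T : ℝ≥0) :
    Measurable fun ω => (N ω).stieltjes.measure.restrict (Ioc 0 (T : ℝ)) := by
  have hfin : ∀ ω, IsFiniteMeasure ((N ω).stieltjes.measure.restrict (Ioc 0 (T : ℝ))) :=
    fun ω => ⟨by simp [(N ω).measure_Ioc_zero T]⟩
  have hN' : ∀ t, Measurable fun ω => ((N ω t : ℕ) : ℝ≥0∞) := fun t =>
    (measurable_from_top (f := fun n : ℕ => (n : ℝ≥0∞))).comp (hN t)
  refine Measurable.measure_of_isPiSystem (borel_eq_generateFrom_Iic ℝ ▸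
      (BorelSpace.measurable_eq (α := ℝ))) isPiSystem_Iic ?_ ?_
  · rintro _ ⟨a, rfl⟩
    simp only [Measure.restrict_apply measurableSet_Iic, Iic_inter_Ioc_zero,
      CountingPath.measure_Ioc_zero]
    exact hN' _
  · simp only [Measure.restrict_apply_univ, CountingPath.measure_Ioc_zero]
    exact hN' _

lemma measurable_stieltjes_inter_Ioc {N : Ω → CountingPath}
    (hN : ∀ t, Measurable fun ω => N ω t) {B : Set ℝ} (hB : MeasurableSet B) (T : ℝ≥0) :
    Measurable fun ω => (N ω).stieltjes.measure (B ∩ Ioc 0 (T : ℝ)) := by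
  simpa only [Function.comp_def, Measure.restrict_apply hB] using
    (Measure.measurable_coe hB).comp (measurable_restrict_stieltjes hN T)

end Measurability

/-! ### Mean measure of a Poisson process. -/

lemma lintegral_natCast_poissonMeasure (r : ℝ≥0) :
    ∫⁻ n, (n : ℝ≥0∞) ∂poissonMeasure r = r := by
  rw [lintegral_countable', ← ENNReal.ofReal_coe_nnreal]
  have hs : HasSum (fun n : ℕ => (n : ℝ) * (Real.exp (-r) * r ^ n / n.factorial)) r := by
    -- The term n = 0 vanishes; after the shift, n + 1 cancels against (n + 1)! and leaves r times
    -- the total mass.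
    rw [← hasSum_nat_add_iff' 1]
    have h := (hasSum_one_poissonMeasure r).mul_left (r : ℝ)
    simp only [Finset.range_one, Finset.sum_singleton, CharP.cast_eq_zero, zero_mul, sub_zero]
    rw [mul_one] at h
    have hfun : (fun n : ℕ => ((n + 1 : ℕ) : ℝ) *
        (Real.exp (-r) * r ^ (n + 1) / (n + 1).factorial))
        = fun n => (r : ℝ) * (Real.exp (-r) * r ^ n / n.factorial) := by
      funext n
      rw [Nat.factorial_succ]
      push_cast
      field_simp
      ring
    rwa [hfun]
  rw [← hs.tsum_eq, ENNReal.ofReal_tsum_of_nonneg (fun n => by positivity) hs.summable]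
  refine tsum_congr fun n => ?_
  rw [poissonMeasure_singleton, ENNReal.ofReal_mul (Nat.cast_nonneg _), ENNReal.ofReal_natCast]

section Mean

variable {Ω : Type*} [MeasurableSpace Ω] {P : Measure Ω} {r : ℝ≥0} {N : Ω → CountingPath}

lemma IsPoissonProcess.lintegral_increment (hN : IsPoissonProcess P r N) {s t : ℝ≥0}
    (h : s ≤ t) : ∫⁻ ω, ((N ω t - N ω s : ℕ) : ℝ≥0∞) ∂P = r * (t - s : ℝ≥0) := by
  have hm : Measurable fun ω => N ω t - N ω s := (hN.measurable t).sub (hN.measurable s)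
  rw [← ENNReal.coe_mul, ← lintegral_natCast_poissonMeasure, ← hN.law_increment s t h,
    lintegral_map measurable_from_top hm]

/-- As functions of `B`, both sides are finite measures, and they agree on half-open intervals by
the law of the increments. -/
lemma IsPoissonProcess.lintegral_measure (hN : IsPoissonProcess P r N) (T : ℝ≥0) {B : Set ℝ}
    (hB : MeasurableSet B) :
    ∫⁻ ω, (N ω).stieltjes.measure (B ∩ Ioc 0 (T : ℝ)) ∂P = r * volume (B ∩ Ioc 0 (T : ℝ)) := by
  have hm := measurable_restrict_stieltjes hN.measurable T
  have hbind : ∀ B : Set ℝ, MeasurableSet B →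
      P.bind (fun ω => (N ω).stieltjes.measure.restrict (Ioc 0 (T : ℝ))) B
        = ∫⁻ ω, (N ω).stieltjes.measure (B ∩ Ioc 0 (T : ℝ)) ∂P := fun B hB => by
    rw [Measure.bind_apply hB hm.aemeasurable]
    simp only [Measure.restrict_apply hB]
  have hincr : ∀ a b : ℝ≥0,
      ∫⁻ ω, (N ω).stieltjes.measure (Ioc (a : ℝ) b) ∂P = r * volume (Ioc (a : ℝ) b) := fun a b => by
    rcases le_total a b with h | h
    · simp only [CountingPath.measure_Ioc]
      rw [hN.lintegral_increment h, Real.volume_Ioc, ← NNReal.coe_sub h, ENNReal.ofReal_coe_nnreal]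
    · simp [Ioc_eq_empty (not_lt.2 (NNReal.coe_le_coe.2 h))]
  have hfin : IsFiniteMeasure
      (P.bind fun ω => (N ω).stieltjes.measure.restrict (Ioc 0 (T : ℝ))) := by
    refine ⟨?_⟩
    have h0 := hincr 0 T
    rw [NNReal.coe_zero] at h0
    rw [hbind _ MeasurableSet.univ]
    simp only [univ_inter]
    rw [h0]
    exact ENNReal.mul_lt_top ENNReal.coe_lt_top (by simp)
  suffices h : P.bind (fun ω => (N ω).stieltjes.measure.restrict (Ioc 0 (T : ℝ)))
      = (r : ℝ≥0∞) • (volume.restrict (Ioc 0 (T : ℝ))) by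
    rw [← hbind B hB, h]
    simp [Measure.restrict_apply hB]
  refine Measure.ext_of_Ioc _ _ fun a b _ => ?_
  have hset : Ioc a b ∩ Ioc 0 (T : ℝ)
      = Ioc ((a.toNNReal : ℝ≥0) : ℝ) ((min b.toNNReal T : ℝ≥0) : ℝ) := by
    ext x
    simp only [Ioc_inter_Ioc, mem_Ioc, NNReal.coe_min, Real.coe_toNNReal', sup_lt_iff, le_inf_iff,
      le_max_iff]
    constructor
    · rintro ⟨⟨h1, h2⟩, h3, h4⟩; exact ⟨⟨h1, h2⟩, Or.inl h3, h4⟩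
    · rintro ⟨⟨h1, h2⟩, h3 | h3, h4⟩
      · exact ⟨⟨h1, h2⟩, h3, h4⟩
      · linarith
  rw [hbind _ measurableSet_Ioc, hset, hincr,
    Measure.smul_apply, smul_eq_mul, Measure.restrict_apply measurableSet_Ioc, hset]

/-- A Poisson process is unlikely to have an arrival in a set of small measure. -/
lemma IsPoissonProcess.measure_ne_zero_le (hN : IsPoissonProcess P r N) (T : ℝ≥0) {B : Set ℝ}
    (hB : MeasurableSet B) :
    P {ω | (N ω).stieltjes.measure (B ∩ Ioc 0 (T : ℝ)) ≠ 0} ≤ r * volume (B ∩ Ioc 0 (T : ℝ)) := by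
  rw [← hN.lintegral_measure T hB]
  refine le_trans (measure_mono fun ω hω => ?_)
    ((one_mul _).symm.trans_le (mul_meas_ge_le_lintegral₀
      (measurable_stieltjes_inter_Ioc hN.measurable hB T).aemeasurable 1))
  -- Markov's inequality at level 1 applies because a nonzero count is an integer, hence at least 1.
  obtain ⟨n, hn⟩ := (N ω).exists_measure_eq_natCast T hB
  simp only [mem_ofPred_eq, hn] at hω ⊢
  exact_mod_cast Nat.one_le_iff_ne_zero.2 (by exact_mod_cast hω)

lemma IsPoissonProcess.measure_increment_ne_le (hN : IsPoissonProcess P r N) (s t : ℝ≥0) :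
    P {ω | N ω s ≠ N ω t} ≤ r * ENNReal.ofReal |(t : ℝ) - s| := by
  wlog h : s ≤ t generalizing s t
  · have := this t s (le_of_not_ge h)
    rwa [abs_sub_comm, show {ω | N ω s ≠ N ω t} = {ω | N ω t ≠ N ω s} by ext; exact ne_comm]
  have h1 := hN.measure_ne_zero_le t (measurableSet_Ioi (a := (s : ℝ)))
  have hset : Ioi (s : ℝ) ∩ Ioc 0 (t : ℝ) = Ioc (s : ℝ) t := by
    ext x
    simp only [mem_inter_iff, mem_Ioi, mem_Ioc]
    exact ⟨fun h => ⟨h.1, h.2.2⟩, fun h => ⟨h.1, s.2.trans_lt h.1, h.2⟩⟩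
  simp only [hset, CountingPath.measure_Ioc, Real.volume_Ioc] at h1
  rw [abs_of_nonneg (sub_nonneg.2 (NNReal.coe_le_coe.2 h))]
  refine le_trans (measure_mono fun ω hω => ?_) h1
  have := (N ω).mono' h
  simp only [mem_ofPred_eq] at hω ⊢
  exact_mod_cast (by omega : N ω t - N ω s ≠ 0)

end Mean

/-! ### Time change for finite unions of intervals. -/

section

/-- A set of reals is adapted to a finite set `Q` if membership of a point only depends on the
position of the point relative to `Q`. -/
def IsAdapted (Q : Finset ℝ) (B : Set ℝ) : Prop :=
  ∀ ⦃x y : ℝ⦄, (∀ q ∈ Q, x ≤ q ↔ y ≤ q) → (x ∈ B ↔ y ∈ B)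

/-- The time that the set `B` occupies in `(0, t]`. -/
noncomputable def occupation (B : Set ℝ) (t : ℝ≥0) : ℝ≥0 :=
  (volume (B ∩ Ioc 0 (t : ℝ))).toNNReal

lemma volume_inter_Ioc_ne_top (B : Set ℝ) (a b : ℝ) : volume (B ∩ Ioc a b) ≠ ∞ :=
  ((measure_mono inter_subset_right).trans_lt measure_Ioc_lt_top).ne

lemma coe_occupation (B : Set ℝ) (t : ℝ≥0) :
    (occupation B t : ℝ≥0∞) = volume (B ∩ Ioc 0 (t : ℝ)) :=
  ENNReal.coe_toNNReal (volume_inter_Ioc_ne_top B 0 t)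

lemma occupation_mono (B : Set ℝ) : Monotone (occupation B) := fun s t h => by
  rw [← ENNReal.coe_le_coe, coe_occupation, coe_occupation]
  exact measure_mono (inter_subset_inter_right _ (Ioc_subset_Ioc_right h))

lemma measureReal_inter_Ioc_add (μ : Measure ℝ) [IsLocallyFiniteMeasure μ] {B : Set ℝ}
    (hB : MeasurableSet B) {s t : ℝ≥0} (h : s ≤ t) :
    μ.real (B ∩ Ioc 0 (t : ℝ)) = μ.real (B ∩ Ioc 0 (s : ℝ)) + μ.real (B ∩ Ioc (s : ℝ) t) := by
  have hfin : ∀ a b, μ (B ∩ Ioc a b) ≠ ∞ := fun a b =>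
    ((measure_mono inter_subset_right).trans_lt measure_Ioc_lt_top).ne
  rw [← measureReal_union _ (hB.inter measurableSet_Ioc) (hfin _ _) (hfin _ _),
    ← inter_union_distrib_left, Ioc_union_Ioc_eq_Ioc s.coe_nonneg (NNReal.coe_le_coe.2 h)]
  exact (Ioc_disjoint_Ioc_of_le le_rfl).mono inter_subset_right inter_subset_right

/-- An adapted set is a finite union of intervals closed on the right at points of `Q`. A cell
without points of `Q` strictly inside is therefore entirely in or out, as its right endpoint
decides. -/
lemma inter_Ioc_eq_of_isAdapted {Q : Finset ℝ} {B : Set ℝ} (hQ : IsAdapted Q B) {s t : ℝ}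
    (hst : ∀ q ∈ Q, q ≤ s ∨ t ≤ q) [Decidable (t ∈ B)] :
    B ∩ Ioc s t = if t ∈ B then Ioc s t else ∅ := by
  have key : ∀ x ∈ Ioc s t, (x ∈ B ↔ t ∈ B) := fun x hx => hQ fun q hq => by
    rcases hst q hq with h | h
    · exact ⟨fun h' => absurd (h'.trans h) (not_le.2 hx.1),
        fun h' => (hx.2.trans h')⟩
    · exact ⟨fun _ => h, fun _ => hx.2.trans h⟩
  ext x
  split_ifs with h
  · exact ⟨fun hx => hx.2, fun hx => ⟨(key x hx).2 h, hx⟩⟩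
  · exact ⟨fun hx => h ((key x hx.2).1 hx.1), fun hx => hx.elim⟩

/-- Lets one deterministic map recover both processes from their increments, so that equality in law
passes from increments to values. -/
lemma eq_sum_of_succ_eq_add {n : ℕ} {G : Fin (n + 1) → ℝ} {x : Fin n → ℝ} (h0 : G 0 = 0)
    (h : ∀ j, G j.succ = G j.castSucc + x j) (k : Fin (n + 1)) :
    G k = ∑ j, if j.castSucc < k then x j else 0 := by
  induction k using Fin.induction with
  | zero => simp [h0]
  | succ i ih =>
    rw [h, ih]
    have : x i = ∑ j, if j = i then x j else 0 := by simp
    conv_lhs => rw [this]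
    rw [← Finset.sum_add_distrib]
    refine Finset.sum_congr rfl fun j _ => ?_
    simp only [Fin.lt_def, Fin.ext_iff, Fin.val_castSucc, Fin.val_succ]
    rcases lt_trichotomy (j : ℕ) i with h | h | h
    · rw [if_pos h, if_neg h.ne, if_pos (by omega), add_zero]
    · rw [if_neg (by omega), if_pos h, if_pos (by omega), zero_add]
    · rw [if_neg (by omega), if_neg h.ne', if_neg (by omega), add_zero]

/-- A finite set of times is contained in the range of a monotone sequence starting at `0`. -/
lemma exists_monotone_partition (S : Finset ℝ≥0) :
    ∃ (n : ℕ) (τ : Fin (n + 1) → ℝ≥0), Monotone τ ∧ τ 0 = 0 ∧ (∀ s ∈ S, ∃ k, τ k = s) ∧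
      ∀ s ∈ S, ∀ j : Fin n, s ≤ τ j.castSucc ∨ τ j.succ ≤ s := by
  classical
  obtain ⟨n, hn⟩ : ∃ n, (insert 0 S).card = n + 1 :=
    ⟨_, (Nat.succ_pred_eq_of_pos (Finset.card_pos.2 ⟨0, Finset.mem_insert_self _ _⟩)).symm⟩
  have hr : ∀ s ∈ insert 0 S, ∃ k, (insert 0 S).orderEmbOfFin hn k = s := fun s hs => by
    have := (insert 0 S).range_orderEmbOfFin hn
    exact (Set.ext_iff.1 this s).2 hs
  have hmono := ((insert 0 S).orderEmbOfFin hn).monotone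
  refine ⟨n, (insert 0 S).orderEmbOfFin hn, hmono, ?_,
    fun s hs => hr s (Finset.mem_insert_of_mem hs), fun s hs j => ?_⟩
  · obtain ⟨k, hk⟩ := hr 0 (Finset.mem_insert_self _ _)
    exact le_antisymm ((hmono (Fin.zero_le k)).trans_eq hk) zero_le
  · obtain ⟨k, rfl⟩ := hr s (Finset.mem_insert_of_mem hs)
    rcases le_or_gt k j.castSucc with h | h
    · exact Or.inl (hmono h)
    · exact Or.inr (hmono (Fin.castSucc_lt_iff_succ_le.1 h))

variable {Ω : Type*} [MeasurableSpace Ω] {P : Measure Ω} [IsProbabilityMeasure P] {r : ℝ≥0}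
  {N : Ω → CountingPath}

lemma poissonMeasure_zero_eq_dirac : poissonMeasure 0 = Measure.dirac 0 := by
  refine Measure.ext_of_singleton fun n => ?_
  rw [poissonMeasure_singleton, Measure.dirac_apply' _ (measurableSet_singleton n)]
  rcases n with _ | n <;> simp

/-- The arrivals in an adapted set and those in the time-changed process have the same
finite-dimensional laws. -/
lemma IsPoissonProcess.map_measureReal_eq_of_isAdapted (hN : IsPoissonProcess P r N)
    {Q : Finset ℝ} {B : Set ℝ} (hQ : IsAdapted Q B) (hB : MeasurableSet B)
    {ι : Type*} [Fintype ι] (t : ι → ℝ≥0) :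
    P.map (fun ω i => (N ω).stieltjes.measure.real (B ∩ Ioc 0 (t i : ℝ)))
      = P.map (fun ω i => (N ω (occupation B (t i)) : ℝ)) := by
  classical
  obtain ⟨n, τ, hmono, h0, hS, hsep⟩ :=
    exists_monotone_partition (Q.image Real.toNNReal ∪ Finset.univ.image t)
  have ht : ∀ i, ∃ k, τ k = t i := fun i => hS _ (by simp)
  choose k hk using ht
  have hτ : ∀ j : Fin n, τ j.castSucc ≤ τ j.succ := fun j => hmono (Fin.castSucc_lt_succ).le
  have hcell : ∀ j : Fin n, B ∩ Ioc (τ j.castSucc : ℝ) (τ j.succ)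
      = if (τ j.succ : ℝ) ∈ B then Ioc (τ j.castSucc : ℝ) (τ j.succ) else ∅ := fun j => by
    refine inter_Ioc_eq_of_isAdapted hQ fun q hq => ?_
    rcases hsep q.toNNReal (Finset.mem_union_left _ (Finset.mem_image_of_mem _ hq)) j with h | h
    · exact Or.inl (Real.toNNReal_le_iff_le_coe.1 h)
    -- Points of `Q` were clipped at 0; a nonpositive one lies to the left of every cell.
    · rcases le_or_gt q 0 with h' | h'
      · exact Or.inl (h'.trans (τ j.castSucc).2)
      · exact Or.inr ((Real.le_toNNReal_iff_coe_le h'.le).1 h)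
  let X : Fin n → Ω → ℕ := fun j ω =>
    (if (τ j.succ : ℝ) ∈ B then id else fun _ => 0) (N ω (τ j.succ) - N ω (τ j.castSucc))
  let Y : Fin n → Ω → ℕ := fun j ω =>
    N ω (occupation B (τ j.succ)) - N ω (occupation B (τ j.castSucc))
  have hXm : ∀ j, Measurable (X j) := fun j =>
    measurable_from_top.comp ((hN.measurable _).sub (hN.measurable _))
  have hYm : ∀ j, Measurable (Y j) := fun j => (hN.measurable _).sub (hN.measurable _)
  have hXi : iIndepFun X P :=
    (hN.indepIncrements n τ hmono).comp
      (fun j : Fin n => (if (τ j.succ : ℝ) ∈ B then id else fun _ => 0 : ℕ → ℕ))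
      fun _ => measurable_from_top
  have hYi : iIndepFun Y P :=
    hN.indepIncrements n (fun j => occupation B (τ j)) ((occupation_mono B).comp hmono)
  have hocc : ∀ j : Fin n, occupation B (τ j.succ) - occupation B (τ j.castSucc)
      = if (τ j.succ : ℝ) ∈ B then τ j.succ - τ j.castSucc else 0 := fun j => by
    have h1 := measureReal_inter_Ioc_add volume hB (hτ j)
    have h2 : ∀ t : ℝ≥0, volume.real (B ∩ Ioc 0 (t : ℝ)) = occupation B t := fun t => rfl
    rw [h2, h2, hcell] at h1
    rw [← NNReal.coe_inj, NNReal.coe_sub (occupation_mono B (hτ j)), h1, add_sub_cancel_left]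
    split_ifs with h
    · rw [Real.volume_real_Ioc_of_le (NNReal.coe_le_coe.2 (hτ j)), NNReal.coe_sub (hτ j)]
    · simp
  -- On a cell inside `B` both increments are Poisson with the mean given by the cell's length; on a
  -- cell outside `B` both vanish almost surely, the occupation time being constant there.
  have hlaw : ∀ j, P.map (X j) = P.map (Y j) := fun j => by
    have hY : P.map (Y j) = _ := hN.law_increment _ _ (occupation_mono B (hτ j))
    rw [hY, hocc]
    by_cases h : (τ j.succ : ℝ) ∈ B
    · rw [if_pos h, ← hN.law_increment _ _ (hτ j)]
      simp only [X, if_pos h, id]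
    · simp only [X, if_neg h]
      rw [mul_zero, poissonMeasure_zero_eq_dirac, Measure.map_const]
      simp
  have hjoint : P.map (fun ω j => X j ω) = P.map (fun ω j => Y j ω) := by
    rw [(iIndepFun_iff_map_fun_eq_pi_map fun j => (hXm j).aemeasurable).1 hXi,
      (iIndepFun_iff_map_fun_eq_pi_map fun j => (hYm j).aemeasurable).1 hYi]
    simp only [hlaw]
  let g : (Fin n → ℕ) → ι → ℝ := fun x i => ∑ j, if j.castSucc < k i then (x j : ℝ) else 0
  have hg : Measurable g := Measurable.of_discrete
  have hgX : (fun ω i => (N ω).stieltjes.measure.real (B ∩ Ioc 0 (t i : ℝ)))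
      = g ∘ fun ω j => X j ω := by
    funext ω i
    rw [← hk i]
    refine eq_sum_of_succ_eq_add
      (G := fun k => (N ω).stieltjes.measure.real (B ∩ Ioc 0 (τ k : ℝ))) (by simp [h0])
      (fun j => ?_) (k i)
    simp only
    rw [measureReal_inter_Ioc_add _ hB (hτ j), hcell]
    congr 1
    by_cases h : (τ j.succ : ℝ) ∈ B
    · simp only [X, if_pos h, id, Measure.real, CountingPath.measure_Ioc, ENNReal.toReal_natCast]
    · simp [X, h]
  have hgY : (fun ω i => (N ω (occupation B (t i)) : ℝ)) = g ∘ fun ω j => Y j ω := by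
    funext ω i
    rw [← hk i]
    refine eq_sum_of_succ_eq_add
      (G := fun k => (N ω (occupation B (τ k)) : ℝ)) (by simp [h0, occupation, (N ω).zero'])
      (fun j => ?_) (k i)
    simp only [Y]
    rw [Nat.cast_sub ((N ω).mono' (occupation_mono B (hτ j)))]
    ring
  rw [hgX, hgY, ← Measure.map_map hg (measurable_pi_lambda _ hXm),
    ← Measure.map_map hg (measurable_pi_lambda _ hYm), hjoint]

end

/-! ### Time change for measurable sets, by approximation. -/

section

lemma IsAdapted.mono {Q Q' : Finset ℝ} {B : Set ℝ} (h : IsAdapted Q B) (hQ : Q ⊆ Q') :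
    IsAdapted Q' B := fun _ _ hxy => h fun q hq => hxy q (hQ hq)

lemma isSetRing_isAdapted :
    IsSetRing {B : Set ℝ | MeasurableSet B ∧ ∃ Q : Finset ℝ, IsAdapted Q B} := by
  classical
  refine ⟨⟨MeasurableSet.empty, ∅, fun _ _ _ => Iff.rfl⟩, ?_, ?_⟩
  · rintro s t ⟨hs, Q, hQ⟩ ⟨ht, Q', hQ'⟩
    refine ⟨hs.union ht, Q ∪ Q', fun x y hxy => ?_⟩
    exact or_congr (hQ.mono Finset.subset_union_left hxy) (hQ'.mono Finset.subset_union_right hxy)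
  · rintro s t ⟨hs, Q, hQ⟩ ⟨ht, Q', hQ'⟩
    refine ⟨hs.diff ht, Q ∪ Q', fun x y hxy => ?_⟩
    exact and_congr (hQ.mono Finset.subset_union_left hxy)
      (not_congr (hQ'.mono Finset.subset_union_right hxy))

lemma exists_isAdapted_volume_symmDiff_lt {B : Set ℝ} (hB : MeasurableSet B) (T : ℝ)
    {ε : ℝ≥0∞} (hε : 0 < ε) :
    ∃ (Q : Finset ℝ) (B' : Set ℝ), IsAdapted Q B' ∧ MeasurableSet B' ∧
      volume (symmDiff B' B ∩ Ioc 0 T) < ε := by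
  have hgen : (inferInstance : MeasurableSpace ℝ) = MeasurableSpace.generateFrom
      {B : Set ℝ | MeasurableSet B ∧ ∃ Q : Finset ℝ, IsAdapted Q B} := by
    refine le_antisymm (((BorelSpace.measurable_eq (α := ℝ)).trans
      (borel_eq_generateFrom_Iic ℝ)).trans_le (MeasurableSpace.generateFrom_mono ?_))
      (MeasurableSpace.generateFrom_le fun t ht => ht.1)
    rintro _ ⟨a, rfl⟩
    exact ⟨measurableSet_Iic, {a}, fun x y hxy => hxy a (Finset.mem_singleton_self a)⟩
  have huniv : (univ : Set ℝ) ∈ {B : Set ℝ | MeasurableSet B ∧ ∃ Q : Finset ℝ, IsAdapted Q B} :=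
    ⟨MeasurableSet.univ, ∅, fun _ _ _ => Iff.rfl⟩
  obtain ⟨B', ⟨hB', Q, hQ⟩, hlt⟩ := exists_measure_symmDiff_lt_of_generateFrom_isSetRing
    (μ := volume.restrict (Ioc 0 T)) isSetRing_isAdapted
    ⟨{univ}, countable_singleton _, by simpa using huniv, by simp⟩ hgen hB hε
  exact ⟨Q, B', hQ, hB', by rwa [Measure.restrict_apply (hB'.symmDiff hB)] at hlt⟩

lemma abs_occupation_sub_le {B B' : Set ℝ} (hB : MeasurableSet B) (hB' : MeasurableSet B')
    {s t : ℝ≥0} (h : s ≤ t) :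
    ENNReal.ofReal |(occupation B s : ℝ) - occupation B' s|
      ≤ volume (symmDiff B' B ∩ Ioc 0 (t : ℝ)) := by
  have h1 := abs_measureReal_sub_le_measureReal_symmDiff (μ := volume.restrict (Ioc 0 (t : ℝ)))
    (hB.inter (measurableSet_Ioc (a := (0 : ℝ)) (b := s))).nullMeasurableSet
    (hB'.inter (measurableSet_Ioc (a := (0 : ℝ)) (b := s))).nullMeasurableSet
  have h2 : ∀ A : Set ℝ, MeasurableSet A →
      (volume.restrict (Ioc 0 (t : ℝ))).real (A ∩ Ioc 0 (s : ℝ)) = occupation A s := fun A hA => by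
    rw [measureReal_restrict_apply (hA.inter measurableSet_Ioc), inter_assoc,
      inter_eq_left.2 (Ioc_subset_Ioc_right (NNReal.coe_le_coe.2 h))]
    rfl
  rw [h2 B hB, h2 B' hB'] at h1
  refine (ENNReal.ofReal_le_ofReal h1).trans ?_
  rw [ofReal_measureReal, ← inter_symmDiff_distrib_right,
    Measure.restrict_apply ((hB.symmDiff hB').inter measurableSet_Ioc), symmDiff_comm B]
  exact measure_mono (inter_subset_inter_left _ inter_subset_left)

variable {Ω : Type*} [MeasurableSpace Ω] {P : Measure Ω} {r : ℝ≥0}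
  {N : Ω → CountingPath}

lemma measurable_measureReal_inter_Ioc (hN : ∀ t, Measurable fun ω => N ω t) {B : Set ℝ}
    (hB : MeasurableSet B) (t : ℝ≥0) :
    Measurable fun ω => (N ω).stieltjes.measure.real (B ∩ Ioc 0 (t : ℝ)) :=
  (measurable_stieltjes_inter_Ioc hN hB t).ennreal_toReal

/-- **Time change.** The arrivals of a Poisson process in a measurable set of times have the
finite-dimensional laws of the process run at the occupation time of the set. -/
lemma IsPoissonProcess.map_measureReal_eq [IsProbabilityMeasure P] (hN : IsPoissonProcess P r N)
    {B : Set ℝ} (hB : MeasurableSet B) {ι : Type*} [Fintype ι] (t : ι → ℝ≥0) :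
    P.map (fun ω i => (N ω).stieltjes.measure.real (B ∩ Ioc 0 (t i : ℝ)))
      = P.map (fun ω i => (N ω (occupation B (t i)) : ℝ)) := by
  have hX : ∀ {A : Set ℝ}, MeasurableSet A →
      Measurable fun ω i => (N ω).stieltjes.measure.real (A ∩ Ioc 0 (t i : ℝ)) := fun hA =>
    measurable_pi_lambda _ fun i => measurable_measureReal_inter_Ioc hN.measurable hA (t i)
  have hY : ∀ {A : Set ℝ}, Measurable fun ω i => (N ω (occupation A (t i)) : ℝ) := fun {A} =>
    measurable_pi_lambda _ fun i => measurable_from_top.comp (hN.measurable _)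
  have := Measure.isProbabilityMeasure_map (μ := P) (hX hB).aemeasurable
  have := Measure.isProbabilityMeasure_map (μ := P) (hY (A := B)).aemeasurable
  -- Between probability measures, domination on all events forces equality, so a one-sided estimate
  -- is enough.
  refine Measure.eq_of_le_of_isProbabilityMeasure (Measure.le_iff.2 fun E hE => ?_)
  rw [Measure.map_apply (hX hB) hE, Measure.map_apply hY hE]
  refine ENNReal.le_of_forall_pos_le_add fun ε hε _ => ?_
  set T : ℝ≥0 := Finset.univ.sup t
  have hT : ∀ i, t i ≤ T := fun i => Finset.le_sup (Finset.mem_univ i)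
  -- Replacing `B` by `B'` costs rδ in the counts, and replacing the occupation times costs rδ for
  -- each index. The final + 1 keeps `c` positive when r = 0.
  set c : ℝ≥0 := (Fintype.card ι + 1) * r + 1
  have hc : 0 < c := by positivity
  obtain ⟨Q, B', hQ, hB', hlt⟩ := exists_isAdapted_volume_symmDiff_lt hB T
    (ε := (ε / c : ℝ≥0)) (by exact_mod_cast div_pos hε hc)
  set δ := volume (symmDiff B' B ∩ Ioc 0 (T : ℝ))
  have h1 : P ((fun ω i => (N ω).stieltjes.measure.real (B ∩ Ioc 0 (t i : ℝ))) ⁻¹' E)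
      ≤ P ((fun ω i => (N ω).stieltjes.measure.real (B' ∩ Ioc 0 (t i : ℝ))) ⁻¹' E) + r * δ := by
    refine le_trans (measure_mono ?_) ((measure_union_le _ _).trans
      (add_le_add_right (hN.measure_ne_zero_le T (hB'.symmDiff hB)) _))
    intro ω hω
    by_cases h : (N ω).stieltjes.measure (symmDiff B' B ∩ Ioc 0 (T : ℝ)) = 0
    · refine Or.inl ?_
      suffices heq : ∀ i, (N ω).stieltjes.measure.real (B' ∩ Ioc 0 (t i : ℝ))
          = (N ω).stieltjes.measure.real (B ∩ Ioc 0 (t i : ℝ)) by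
        simpa only [mem_preimage, heq] using hω
      intro i
      have hae : (B' ∩ Ioc 0 (t i : ℝ) : Set ℝ)
          =ᵐ[(N ω).stieltjes.measure] (B ∩ Ioc 0 (t i : ℝ) : Set ℝ) := by
        rw [← measure_symmDiff_eq_zero_iff, ← inter_symmDiff_distrib_right]
        exact measure_mono_null
          (inter_subset_inter_right _ (Ioc_subset_Ioc_right (NNReal.coe_le_coe.2 (hT i)))) h
      exact measureReal_congr hae
    · exact Or.inr h
  have h2 : P ((fun ω i => (N ω (occupation B' (t i)) : ℝ)) ⁻¹' E)
      ≤ P ((fun ω i => (N ω (occupation B (t i)) : ℝ)) ⁻¹' E) + Fintype.card ι * (r * δ) := by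
    have hsum : P (⋃ i, {ω | N ω (occupation B' (t i)) ≠ N ω (occupation B (t i))})
        ≤ Fintype.card ι * (r * δ) := by
      refine (measure_iUnion_fintype_le _ _).trans ?_
      refine (Finset.sum_le_card_nsmul _ _ (r * δ) fun i _ => ?_).trans (by simp)
      exact (hN.measure_increment_ne_le _ _).trans
        (mul_le_mul_right (abs_occupation_sub_le hB hB' (hT i)) _)
    refine le_trans (measure_mono ?_) ((measure_union_le _ _).trans (add_le_add_right hsum _))
    intro ω hω
    by_cases h : ∀ i, N ω (occupation B' (t i)) = N ω (occupation B (t i))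
    · refine Or.inl ?_
      simpa only [mem_preimage, h] using hω
    · push Not at h
      exact Or.inr (mem_iUnion.2 h)
  have h3 : P ((fun ω i => (N ω).stieltjes.measure.real (B' ∩ Ioc 0 (t i : ℝ))) ⁻¹' E)
      = P ((fun ω i => (N ω (occupation B' (t i)) : ℝ)) ⁻¹' E) := by
    rw [← Measure.map_apply (hX hB') hE, ← Measure.map_apply hY hE,
      hN.map_measureReal_eq_of_isAdapted hQ hB' t]
  refine h1.trans ?_
  rw [h3]
  refine (add_le_add_left h2 _).trans ?_
  rw [add_assoc]
  refine add_le_add_right ?_ _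
  calc (Fintype.card ι : ℝ≥0∞) * (r * δ) + r * δ = ((Fintype.card ι + 1) * r) * δ := by ring
    _ ≤ (c : ℝ≥0∞) * (ε / c : ℝ≥0) := by
        refine mul_le_mul' ?_ hlt.le
        simp only [c]
        push_cast
        exact le_self_add
    _ = ε := by rw [← ENNReal.coe_mul, mul_div_cancel₀ _ hc.ne']

variable {Nc : Ω → CountingPath}

lemma indepFun_measureReal
    (hindep : IndepFun (fun ω (t : ℝ≥0) => N ω t) (fun ω (t : ℝ≥0) => Nc ω t) P) {B : Set ℝ}
    (hB : MeasurableSet B) {ι : Type*} (t : ι → ℝ≥0) :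
    IndepFun (fun ω i => N ω (t i))
      (fun ω i => (Nc ω).stieltjes.measure.real (B ∩ Ioc 0 (t i : ℝ))) P := by
  have h1 : IndepFun (fun ω i => N ω (t i)) (fun ω (t : ℝ≥0) => Nc ω t) P :=
    hindep.comp (φ := fun (f : ℝ≥0 → ℕ) i => f (t i)) (ψ := id)
      (measurable_pi_lambda _ fun i => measurable_pi_apply _) measurable_id
  rw [IndepFun_iff_Indep] at h1 ⊢
  refine indep_of_indep_of_le_right h1 (Measurable.comap_le ?_)
  -- The counts in `B` are functions of the costly path: the measurability lemma is applied with Ω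
  -- carrying only the σ-algebra generated by that path.
  let m : MeasurableSpace Ω := MeasurableSpace.comap (fun ω (t : ℝ≥0) => Nc ω t) inferInstance
  have hm : ∀ t : ℝ≥0, Measurable[m] fun ω => Nc ω t := fun t =>
    (measurable_pi_apply t).comp (comap_measurable fun ω (t : ℝ≥0) => Nc ω t)
  exact @measurable_pi_lambda Ω ι (fun _ => ℝ) m _ _ fun i =>
    @measurable_measureReal_inter_Ioc Ω m Nc hm B hB (t i)

/-- The joint law of the free arrivals and the costly arrivals in a set of times. -/
lemma IsPoissonProcess.map_prod_measureReal_eq [IsProbabilityMeasure P]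
    (hN : ∀ t, Measurable fun ω => N ω t)
    (hNc : IsPoissonProcess P r Nc)
    (hindep : IndepFun (fun ω (t : ℝ≥0) => N ω t) (fun ω (t : ℝ≥0) => Nc ω t) P) {B : Set ℝ}
    (hB : MeasurableSet B) {ι : Type*} [Fintype ι] (t : ι → ℝ≥0) :
    P.map (fun ω => (fun i => N ω (t i),
        fun i => (Nc ω).stieltjes.measure.real (B ∩ Ioc 0 (t i : ℝ))))
      = P.map (fun ω => (fun i => N ω (t i), fun i => (Nc ω (occupation B (t i)) : ℝ))) := by
  have hmN : Measurable fun ω i => N ω (t i) := measurable_pi_lambda _ fun i => hN _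
  have hmM : Measurable fun ω i => (Nc ω).stieltjes.measure.real (B ∩ Ioc 0 (t i : ℝ)) :=
    measurable_pi_lambda _ fun i => measurable_measureReal_inter_Ioc hNc.measurable hB (t i)
  have hmY : Measurable fun ω i => (Nc ω (occupation B (t i)) : ℝ) :=
    measurable_pi_lambda _ fun i => measurable_from_top.comp (hNc.measurable _)
  have hY : IndepFun (fun ω i => N ω (t i)) (fun ω i => (Nc ω (occupation B (t i)) : ℝ)) P :=
    hindep.comp (φ := fun (f : ℝ≥0 → ℕ) i => f (t i))
      (ψ := fun (f : ℝ≥0 → ℕ) i => (f (occupation B (t i)) : ℝ))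
      (measurable_pi_lambda _ fun i => measurable_pi_apply _)
      (measurable_pi_lambda _ fun i => measurable_from_top.comp (measurable_pi_apply _))
  rw [(indepFun_iff_map_prod_eq_prod_map_map hmN.aemeasurable hmM.aemeasurable).1
      (indepFun_measureReal hindep hB t),
    (indepFun_iff_map_prod_eq_prod_map_map hmN.aemeasurable hmY.aemeasurable).1 hY,
    hNc.map_measureReal_eq hB t]

end

/-! ### The interruption event in terms of the supply. -/

section

/-- The set of times at which a policy uses the costly server. -/
def OfflinePolicy.activeSet (u : OfflinePolicy) : Set ℝ := {t | u.toFun t = 1}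

lemma OfflinePolicy.measurableSet_activeSet (u : OfflinePolicy) : MeasurableSet u.activeSet :=
  u.measurable' (measurableSet_singleton 1)

lemma OfflinePolicy.natCast_action {R : Type*} [Semiring R] (u : OfflinePolicy) (t : ℝ) :
    (((u.toFun t : Fin 2) : ℕ) : R) = u.activeSet.indicator 1 t := by
  by_cases h : u.toFun t = 1
  · rw [indicator_of_mem (show t ∈ u.activeSet from h), h]
    simp
  · rw [indicator_of_notMem (show t ∉ u.activeSet from h), show u.toFun t = 0 by omega]
    simp

variable {Ω : Type*}

/-- The number of packets available at time `t`, initially or by arrivals, if the costly server is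
used at the times in `B`. -/
noncomputable def supply (D : ℝ≥0) (N Nc : Ω → CountingPath) (B : Set ℝ) (t : ℝ≥0) (ω : Ω) : ℝ :=
  D + N ω t + (Nc ω).stieltjes.measure.real (B ∩ Ioc 0 (t : ℝ))

section Paths

variable (D : ℝ≥0) (N Nc : Ω → CountingPath) (F : ℝ≥0∞)

lemma buffer_action [MeasurableSpace Ω] (u : OfflinePolicy) (t : ℝ≥0) (ω : Ω) :
    buffer D N Nc u.action t ω = supply D N Nc u.activeSet t ω - t := by
  unfold buffer supply OfflinePolicy.action
  simp only [u.natCast_action]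
  rw [integral_indicator_one u.measurableSet_activeSet,
    measureReal_restrict_apply u.measurableSet_activeSet]

lemma supply_nonneg (B : Set ℝ) (t : ℝ≥0) (ω : Ω) : 0 ≤ supply D N Nc B t ω := by
  unfold supply; positivity

lemma supply_mono (B : Set ℝ) (ω : Ω) : Monotone fun t => supply D N Nc B t ω := fun s t h => by
  have h1 : (N ω s : ℝ) ≤ N ω t := Nat.cast_le.2 ((N ω).mono' h)
  have h2 : (Nc ω).stieltjes.measure.real (B ∩ Ioc 0 (s : ℝ))
      ≤ (Nc ω).stieltjes.measure.real (B ∩ Ioc 0 (t : ℝ)) :=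
    measureReal_mono (inter_subset_inter_right _ (Ioc_subset_Ioc_right h))
      ((Nc ω).measure_inter_Ioc_ne_top B 0 t)
  simp only [supply]
  linarith

lemma CountingPath.eventually_eq (f : CountingPath) (t : ℝ≥0) : ∀ᶠ s in 𝓝[≥] t, f s = f t :=
  (f.rightCont' t).eventually (by simp [nhds_discrete] : ∀ᶠ n in 𝓝 (f t), n = f t)

/-- A right-continuous integer-valued path is constant just to the right of each time. This gives
both the strict inequality between the two stopping times and the passage to a dense set of times.
-/
lemma exists_supply_eq {B : Set ℝ} (hB : MeasurableSet B) (t : ℝ≥0) (ω : Ω) :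
    ∃ t' > t, ∀ s, t ≤ s → s < t' → supply D N Nc B s ω = supply D N Nc B t ω := by
  have h := ((N ω).eventually_eq t).and ((Nc ω).eventually_eq t)
  obtain ⟨t', ht', h⟩ := mem_nhdsGE_iff_exists_Ico_subset.1 h
  refine ⟨t', ht', fun s hs hst => ?_⟩
  obtain ⟨h1, h2⟩ := h ⟨hs, hst⟩
  have h3 : (Nc ω).stieltjes.measure.real (B ∩ Ioc (t : ℝ) s) = 0 := by
    rw [measureReal_eq_zero_iff ((Nc ω).measure_inter_Ioc_ne_top B t s)]
    refine measure_mono_null inter_subset_right ?_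
    rw [CountingPath.measure_Ioc, h2, Nat.sub_self, Nat.cast_zero]
  simp only [supply]
  rw [measureReal_inter_Ioc_add _ hB hs, h1, h3, add_zero]

lemma emptyTime_lt_finishTime_iff [MeasurableSpace Ω] (u : OfflinePolicy) (ω : Ω) :
    emptyTime D N Nc u.action ω < finishTime F D N Nc u.action ω ↔
      ∃ t : ℝ≥0, (t : ℝ≥0∞) < F ∧ supply D N Nc u.activeSet t ω ≤ t := by
  have hempty : ∀ t, buffer D N Nc u.action t ω ≤ 0 ↔ supply D N Nc u.activeSet t ω ≤ t := by
    intro t; rw [buffer_action, sub_nonpos]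
  have hfin : ∀ t : ℝ≥0, (F : EReal) - ((t : ℝ) : EReal) ≤ (buffer D N Nc u.action t ω : EReal) ↔
      F ≤ ENNReal.ofReal (supply D N Nc u.activeSet t ω) := by
    intro t
    rw [buffer_action]
    induction F with
    | top =>
      rw [EReal.coe_ennreal_top, EReal.top_sub_coe, top_le_iff, top_le_iff]
      exact iff_of_false (EReal.coe_ne_top _) ENNReal.ofReal_ne_top
    | coe F =>
      rw [EReal.coe_nnreal_eq_coe_real, ← EReal.coe_sub, EReal.coe_le_coe_iff,
        sub_le_sub_iff_right, ← ENNReal.ofReal_coe_nnreal,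
        ENNReal.ofReal_le_ofReal_iff (supply_nonneg D N Nc _ t ω)]
  simp only [emptyTime, finishTime, hempty, hfin]
  constructor
  · intro h
    obtain ⟨t, ht⟩ := iInf_lt_iff.1 h
    obtain ⟨h1, ht⟩ := iInf_lt_iff.1 ht
    have h2 : ENNReal.ofReal (supply D N Nc u.activeSet t ω) < F := by
      by_contra h2
      exact ht.not_ge (iInf₂_le (f := fun (s : ℝ≥0) _ => (s : ℝ≥0∞)) t (not_lt.1 h2))
    -- The time t itself may exceed F. The time S(t) does not, and since S(t) ≤ t, monotonicity
    -- gives S(S(t)) ≤ S(t).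
    refine ⟨(supply D N Nc u.activeSet t ω).toNNReal, h2, ?_⟩
    rw [Real.coe_toNNReal _ (supply_nonneg D N Nc _ t ω)]
    exact supply_mono D N Nc _ ω (Real.toNNReal_le_iff_le_coe.2 h1)
  · rintro ⟨t, htF, ht⟩
    have h2 : ENNReal.ofReal (supply D N Nc u.activeSet t ω) < F :=
      lt_of_le_of_lt ((ENNReal.ofReal_le_ofReal ht).trans_eq ENNReal.ofReal_coe_nnreal) htF
    -- The download ends when S reaches F. As S(t) ≤ t < F and S is constant on [t, t'), this cannot
    -- happen before t', which is strictly after t.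
    obtain ⟨t', htt', hs⟩ := exists_supply_eq D N Nc u.measurableSet_activeSet t ω
    refine lt_of_le_of_lt (iInf₂_le t ht) (lt_of_lt_of_le (ENNReal.coe_lt_coe.2 htt') ?_)
    refine le_iInf₂ fun s hsF => ENNReal.coe_le_coe.2 ?_
    by_contra hlt
    rcases le_total t s with h | h
    · rw [hs s h (not_le.1 hlt)] at hsF
      exact absurd h2 (not_lt.2 hsF)
    · exact absurd h2 (not_lt.2 (hsF.trans
        (ENNReal.ofReal_le_ofReal (supply_mono D N Nc _ ω h))))

lemma exists_supply_le_iff_denseSeq {B : Set ℝ} (hB : MeasurableSet B) (ω : Ω) :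
    (∃ t : ℝ≥0, (t : ℝ≥0∞) < F ∧ supply D N Nc B t ω ≤ t) ↔
      ∃ n : ℕ, (denseSeq ℝ≥0 n : ℝ≥0∞) < F ∧
        supply D N Nc B (denseSeq ℝ≥0 n) ω ≤ denseSeq ℝ≥0 n := by
  refine ⟨?_, fun ⟨n, hn⟩ => ⟨_, hn⟩⟩
  rintro ⟨t, htF, ht⟩
  obtain ⟨t', htt', hs⟩ := exists_supply_eq D N Nc hB t ω
  obtain ⟨t'', h1, h2⟩ := ENNReal.lt_iff_exists_nnreal_btwn.1 htF
  obtain ⟨_, ⟨n, rfl⟩, h3, h4⟩ := (denseRange_denseSeq ℝ≥0).exists_between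
    (lt_min htt' (ENNReal.coe_lt_coe.1 h1))
  refine ⟨n, (ENNReal.coe_lt_coe.2 (h4.trans_le (min_le_right _ _))).trans h2, ?_⟩
  rw [hs _ h3.le (h4.trans_le (min_le_left _ _))]
  exact ht.trans (NNReal.coe_le_coe.2 h3.le)

end Paths

/-! ### Comparison of interruption probabilities. -/

section Comparison

variable [MeasurableSpace Ω] {P : Measure Ω} [IsProbabilityMeasure P] {r : ℝ≥0}
  {N Nc : Ω → CountingPath}

lemma setOf_interruption_eq (D : ℝ≥0) (F : ℝ≥0∞) (u : OfflinePolicy) :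
    {ω | emptyTime D N Nc u.action ω < finishTime F D N Nc u.action ω}
      = ⋃ n : ℕ, {ω | (denseSeq ℝ≥0 n : ℝ≥0∞) < F ∧
        supply D N Nc u.activeSet (denseSeq ℝ≥0 n) ω ≤ denseSeq ℝ≥0 n} := by
  ext ω
  simp only [mem_ofPred_eq, mem_iUnion]
  rw [emptyTime_lt_finishTime_iff, exists_supply_le_iff_denseSeq D N Nc F u.measurableSet_activeSet]

/-- If before time `F` the set `B'` always contains the interval whose length is the time occupied
by `B` so far, then shortage is at most as likely under `B'` as under `B`. -/
lemma measure_biUnion_shortage_le (hN : ∀ t, Measurable fun ω => N ω t)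
    (hNc : IsPoissonProcess P r Nc)
    (hindep : IndepFun (fun ω (t : ℝ≥0) => N ω t) (fun ω (t : ℝ≥0) => Nc ω t) P)
    (D : ℝ≥0) (F : ℝ≥0∞) {B B' : Set ℝ} (hB : MeasurableSet B)
    (hBB' : ∀ t : ℝ≥0, (t : ℝ≥0∞) < F → Ioc 0 (occupation B t : ℝ) ⊆ B' ∩ Ioc 0 (t : ℝ))
    {ι : Type*} [Fintype ι] (t : ι → ℝ≥0) :
    P (⋃ i, {ω | (t i : ℝ≥0∞) < F ∧ supply D N Nc B' (t i) ω ≤ t i})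
      ≤ P (⋃ i, {ω | (t i : ℝ≥0∞) < F ∧ supply D N Nc B (t i) ω ≤ t i}) := by
  let E : Set ((ι → ℕ) × (ι → ℝ)) := ⋃ i, {x | (t i : ℝ≥0∞) < F ∧ D + (x.1 i : ℝ) + x.2 i ≤ t i}
  have hE : MeasurableSet E := by
    have hcast : Measurable fun n : ℕ => (n : ℝ) := measurable_from_top
    exact MeasurableSet.iUnion fun i => MeasurableSet.inter
      (s₁ := {x : (ι → ℕ) × (ι → ℝ) | (t i : ℝ≥0∞) < F}) (MeasurableSet.const _)
      (measurableSet_le (f := fun x : (ι → ℕ) × (ι → ℝ) => D + (x.1 i : ℝ) + x.2 i)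
        (by fun_prop) measurable_const)
  have hmX : Measurable fun ω => (fun i => N ω (t i),
      fun i => (Nc ω).stieltjes.measure.real (B ∩ Ioc 0 (t i : ℝ))) :=
    (measurable_pi_lambda _ fun i => hN _).prodMk
      (measurable_pi_lambda _ fun i => measurable_measureReal_inter_Ioc hNc.measurable hB (t i))
  have hmY : Measurable fun ω => (fun i => N ω (t i), fun i => (Nc ω (occupation B (t i)) : ℝ)) :=
    (measurable_pi_lambda _ fun i => hN _).prodMk
      (measurable_pi_lambda _ fun i => measurable_from_top.comp (hNc.measurable _))
  have hlaw := congrArg (fun μ => μ E)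
    (IsPoissonProcess.map_prod_measureReal_eq hN hNc hindep hB t)
  simp only [Measure.map_apply hmX hE, Measure.map_apply hmY hE] at hlaw
  have hset : (⋃ i, {ω | (t i : ℝ≥0∞) < F ∧ supply D N Nc B (t i) ω ≤ t i})
      = (fun ω => (fun i => N ω (t i),
        fun i => (Nc ω).stieltjes.measure.real (B ∩ Ioc 0 (t i : ℝ)))) ⁻¹' E := by
    simp only [E, preimage_iUnion]
    rfl
  rw [hset, hlaw]
  -- After the change of law the comparison is pathwise: `B'` collects at least the costly arrivals
  -- of the initial interval.
  refine measure_mono fun ω hω => ?_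
  obtain ⟨i, hF, hi⟩ := mem_iUnion.1 hω
  refine mem_iUnion.2 ⟨i, hF, le_trans ?_ hi⟩
  have h1 : ((Nc ω (occupation B (t i)) : ℕ) : ℝ)
      ≤ (Nc ω).stieltjes.measure.real (B' ∩ Ioc 0 (t i : ℝ)) := by
    have h2 : (Nc ω).stieltjes.measure.real (Ioc 0 (occupation B (t i) : ℝ))
        = Nc ω (occupation B (t i)) := by
      rw [Measure.real, CountingPath.measure_Ioc_zero, ENNReal.toReal_natCast]
    rw [← h2]
    exact measureReal_mono (hBB' _ hF) ((Nc ω).measure_inter_Ioc_ne_top B' 0 (t i))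
  simp only [supply]
  linarith

/-- The countable union over dense times is the increasing limit of finite unions, and each of these
is covered by `measure_biUnion_shortage_le`. -/
lemma interruptionProb_le (hN : ∀ t, Measurable fun ω => N ω t)
    (hNc : IsPoissonProcess P r Nc)
    (hindep : IndepFun (fun ω (t : ℝ≥0) => N ω t) (fun ω (t : ℝ≥0) => Nc ω t) P)
    (D : ℝ≥0) (F : ℝ≥0∞) {u u' : OfflinePolicy}
    (h : ∀ t : ℝ≥0, (t : ℝ≥0∞) < F →
      Ioc 0 (occupation u.activeSet t : ℝ) ⊆ u'.activeSet ∩ Ioc 0 (t : ℝ)) :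
    interruptionProb P F D N Nc u'.action ≤ interruptionProb P F D N Nc u.action := by
  unfold interruptionProb
  refine ENNReal.toReal_mono (measure_ne_top _ _) ?_
  rw [setOf_interruption_eq, setOf_interruption_eq, measure_iUnion_eq_iSup_accumulate]
  refine iSup_le fun n => ?_
  have := measure_biUnion_shortage_le hN hNc hindep D F u.measurableSet_activeSet h
    (fun i : Iic n => denseSeq ℝ≥0 i)
  rw [accumulate_def]
  refine le_trans (measure_mono ?_) (this.trans (measure_mono ?_))
  · exact iUnion₂_subset fun i hi => subset_iUnion_of_subset (⟨i, hi⟩ : Iic n) subset_rfl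
  · exact iUnion_subset fun i => subset_iUnion_of_subset (i : ℕ) subset_rfl

end Comparison

/-! ### Usage times and threshold policies. -/

section Usage

variable [MeasurableSpace Ω] (P : Measure Ω) [IsProbabilityMeasure P] (F : ℝ≥0∞)

lemma expectedUsage_action (u : OfflinePolicy) :
    expectedUsage P F u.action
      = volume (u.activeSet ∩ {t : ℝ | 0 ≤ t ∧ ENNReal.ofReal t ≤ F}) := by
  unfold expectedUsage OfflinePolicy.action
  simp only [u.natCast_action]
  rw [lintegral_const, measure_univ, mul_one, lintegral_indicator_one u.measurableSet_activeSet,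
    Measure.restrict_apply u.measurableSet_activeSet]

lemma volume_setOf_ofReal_le : volume {t : ℝ | 0 ≤ t ∧ ENNReal.ofReal t ≤ F} = F := by
  induction F with
  | top =>
    have : {t : ℝ | 0 ≤ t ∧ ENNReal.ofReal t ≤ ∞} = Ici 0 := by ext; simp
    rw [this, Real.volume_Ici]
  | coe F =>
    have : {t : ℝ | 0 ≤ t ∧ ENNReal.ofReal t ≤ F} = Icc 0 (F : ℝ) := by
      ext t
      simp only [mem_ofPred_eq, mem_Icc, ← ENNReal.ofReal_coe_nnreal (p := F)]
      exact and_congr_right fun _ => ENNReal.ofReal_le_ofReal_iff F.coe_nonneg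
    rw [this, Real.volume_Icc, sub_zero, ENNReal.ofReal_coe_nnreal]

lemma mem_activeSet_thresholdPolicy {ts : ℝ≥0∞} {t : ℝ} :
    t ∈ (thresholdPolicy ts).activeSet ↔ ENNReal.ofReal t ≤ ts := by
  by_cases h : ENNReal.ofReal t ≤ ts <;> simp [OfflinePolicy.activeSet, thresholdPolicy, h]

lemma expectedUsage_thresholdPolicy (ts : ℝ≥0∞) :
    expectedUsage P F (thresholdPolicy ts).action = min ts F := by
  rw [expectedUsage_action, ← volume_setOf_ofReal_le (min ts F)]
  congr 1
  ext t
  simp only [mem_inter_iff, mem_activeSet_thresholdPolicy, mem_ofPred_eq, le_min_iff]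
  tauto

lemma expectedUsage_le (u : OfflinePolicy) : expectedUsage P F u.action ≤ F := by
  rw [expectedUsage_action]
  exact (measure_mono inter_subset_right).trans_eq (volume_setOf_ofReal_le F)

/-- The time used in (0, t] exceeds neither the total usage, because t < F, nor t itself. -/
lemma Ioc_occupation_subset (u : OfflinePolicy) {t : ℝ≥0} (ht : (t : ℝ≥0∞) < F) :
    Ioc 0 (occupation u.activeSet t : ℝ)
      ⊆ (thresholdPolicy (expectedUsage P F u.action)).activeSet ∩ Ioc 0 (t : ℝ) := by
  rintro s ⟨hs0, hs⟩
  have hs' : ENNReal.ofReal s ≤ occupation u.activeSet t :=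
    (ENNReal.ofReal_le_ofReal hs).trans_eq ENNReal.ofReal_coe_nnreal
  rw [coe_occupation] at hs'
  refine ⟨mem_activeSet_thresholdPolicy.2 (hs'.trans ?_), hs0, ?_⟩
  · rw [expectedUsage_action]
    refine measure_mono (inter_subset_inter_right _ fun x hx => ⟨hx.1.le, ?_⟩)
    exact ((ENNReal.ofReal_le_ofReal hx.2).trans_eq ENNReal.ofReal_coe_nnreal).trans ht.le
  · have h1 := hs'.trans (measure_mono inter_subset_right)
    rw [Real.volume_Ioc, sub_zero] at h1
    exact (ENNReal.ofReal_le_ofReal_iff t.coe_nonneg).1 h1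

end Usage

end

end Streaming

theorem mainTheorem6 {Ω : Type*} [MeasurableSpace Ω] (P : Measure Ω) [IsProbabilityMeasure P]
    (R₀ Rc : ℝ≥0) (N Nc : Ω → Streaming.CountingPath)
    (hN : Streaming.IsPoissonProcess P R₀ N) (hNc : Streaming.IsPoissonProcess P Rc Nc)
    (hindep : IndepFun (fun ω (t : ℝ≥0) => N ω t) (fun ω (t : ℝ≥0) => Nc ω t) P)
    (F : ℝ≥0∞) (D : ℝ≥0) :
    -- moving the usage of the costly server to the front
    (∀ u : Streaming.OfflinePolicy,
      Streaming.expectedUsage P F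
          (Streaming.thresholdPolicy (Streaming.expectedUsage P F u.action)).action
        = Streaming.expectedUsage P F u.action ∧
      Streaming.interruptionProb P F D N Nc
          (Streaming.thresholdPolicy (Streaming.expectedUsage P F u.action)).action
        ≤ Streaming.interruptionProb P F D N Nc u.action) ∧
    -- reduction of the minimization over off-line policies to finite thresholds
    ∀ ε : ℝ,
      (∀ u : Streaming.OfflinePolicy, ∃ ts : ℝ≥0,
        Streaming.cost P F D ε N Nc (Streaming.thresholdPolicy ts).action
          ≤ Streaming.cost P F D ε N Nc u.action) ∧
      (⨅ u : Streaming.OfflinePolicy, Streaming.cost P F D ε N Nc u.action)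
        = (⨅ ts : ℝ≥0, Streaming.cost P F D ε N Nc (Streaming.thresholdPolicy ts).action) ∧
      ∀ c : ℝ≥0∞,
        IsLeast (Set.range fun u : Streaming.OfflinePolicy =>
            Streaming.cost P F D ε N Nc u.action) c ↔
          IsLeast (Set.range fun ts : ℝ≥0 =>
            Streaming.cost P F D ε N Nc (Streaming.thresholdPolicy ts).action) c := by
  have hfront : ∀ u : Streaming.OfflinePolicy,
      Streaming.interruptionProb P F D N Nc
          (Streaming.thresholdPolicy (Streaming.expectedUsage P F u.action)).action
        ≤ Streaming.interruptionProb P F D N Nc u.action := fun u =>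
    Streaming.interruptionProb_le hN.measurable hNc hindep D F fun t ht =>
      Streaming.Ioc_occupation_subset P F u ht
  have husage : ∀ u : Streaming.OfflinePolicy,
      Streaming.expectedUsage P F
          (Streaming.thresholdPolicy (Streaming.expectedUsage P F u.action)).action
        = Streaming.expectedUsage P F u.action := fun u => by
    rw [Streaming.expectedUsage_thresholdPolicy, min_eq_left (Streaming.expectedUsage_le P F u)]
  refine ⟨fun u => ⟨husage u, hfront u⟩, fun ε => ?_⟩
  have hred : ∀ u : Streaming.OfflinePolicy, ∃ ts : ℝ≥0,
      Streaming.cost P F D ε N Nc (Streaming.thresholdPolicy ts).action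
        ≤ Streaming.cost P F D ε N Nc u.action := by
    intro u
    by_cases htop : Streaming.expectedUsage P F u.action = ∞
    -- With infinite usage the cost of `u` is infinite, feasible or not, so any finite threshold
    -- will do.
    · refine ⟨0, le_top.trans_eq ?_⟩
      simp only [Streaming.cost, htop, ite_self]
    · refine ⟨(Streaming.expectedUsage P F u.action).toNNReal, ?_⟩
      rw [ENNReal.coe_toNNReal htop]
      unfold Streaming.cost
      rw [husage u]
      split_ifs with h1 h2
      · exact le_rfl
      · exact le_top
      · exact absurd ((hfront u).trans (by assumption)) h1
      · exact le_rfl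
  refine ⟨hred, le_antisymm (le_iInf fun ts => iInf_le _ _) (le_iInf fun u => ?_), fun c => ?_⟩
  · obtain ⟨ts, hts⟩ := hred u
    exact (iInf_le _ ts).trans hts
  · constructor
    · rintro ⟨⟨u, rfl⟩, hc⟩
      obtain ⟨ts, hts⟩ := hred u
      refine ⟨⟨ts, le_antisymm hts (hc ⟨_, rfl⟩)⟩, ?_⟩
      rintro _ ⟨ts', rfl⟩
      exact hc ⟨_, rfl⟩
    · rintro ⟨⟨ts, rfl⟩, hc⟩
      refine ⟨⟨_, rfl⟩, ?_⟩
      rintro _ ⟨u, rfl⟩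
      obtain ⟨ts', hts'⟩ := hred u
      exact (hc ⟨ts', rfl⟩).trans hts'
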